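/- Let $k$ be a field and let $H$ be a Hopf algebra over $k$ with coproduct $\Delta(x)=x_1\otimes x_2$ and counit $\varepsilon$. Let $x\mapsto t_x$ be the canonical linear map from $H$ to the symmetric algebra $S(t_H)$ of (a copy $t_H$ of) the vector space $H$, and let $x\mapsto t^{-1}_x$ be the unique linear map from $H$ to the fraction field $\operatorname{Frac} S(t_H)$ with $t_{x_1}t^{-1}_{x_2}=t^{-1}_{x_1}t_{x_2}=\varepsilon(x)1$ for all $x\in H$. The generic base algebra $\mathcal B_H$ is the $k$-subalgebra of $\operatorname{Frac} S(t_H)$ generated by all elements $$\sigma(x,y)=t_{x_1}t_{y_1}t^{-1}_{x_2y_2},\qquad \sigma^{-1}(x,y)=t_{x_1y_1}t^{-1}_{x_2}t^{-1}_{y_2}\qquad(x,y\in H).$$ Let $T(X_H)$ be the tensor algebra of (a copy $X_H$ of) the vector space $H$, with canonical map $x\mapsto X_x$, a right $H$-comodule algebra under $X_x\mapsto X_{x_1}\otimes x_2$. Let $\mu:T(X_H)\to S(t_H)\otimes H$ be the algebra map with $\mu(X_x)=t_{x_1}\otimes x_2$. The universal comodule algebra is the quotient comodule algebra $\mathcal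 U_H=T(X_H)/\ker\mu$, and $\mathcal V_H=\mathcal U_H^{\mathrm{co}\text{-}H}=\{u\in\mathcal U_H\mid \delta(u)=u\otimes 1\}$, where $\delta$ is the coaction of $\mathcal U_H$, is its subalgebra of coinvariants. The injection $\mathcal U_H\to S(t_H)\otimes H$ induced by $\mu$ maps $\mathcal V_H$ into $S(t_H)\otimes 1=S(t_H)$, and $\mathcal V_H$ is identified with its image in $S(t_H)\subset\operatorname{Frac} S(t_H)$. **Theorem (Iyer).** Let $H=O_k(G)$ be the Hopf algebra of $k$-valued functions on a finite group $G$, and assume that the characteristic of $k$ does not divide the order of $G$. Then $\mathcal B_H$ is a localization of $\mathcal V_H$; that is, $\mathcal V_H\subset\mathcal B_H$, and there is a multiplicative subset $M$ of $\mathcal V_H$ such that this inclusion is the localization $\mathcal V_H\to\mathcal V_H[M^{-1}]$. -/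

import Mathlib

open scoped TensorProduct
open Coalgebra

noncomputable section

namespace GenericBase

/-! ### The Hopf algebra of functions on a finite group -/

/-- The space `O_k(G)` of `k`-valued functions on `G`.  (A type synonym of `G → k`, because
Mathlib equips `G → k` itself with the direct sum coalgebra structure, which ignores the group
law of `G`.) -/
def FunctionHopf (k G : Type*) : Type _ := G → k

namespace FunctionHopf

section Algebra

variable (k G : Type*) [Field k]

/-- Functions are added and multiplied pointwise. -/
instance : CommRing (FunctionHopf k G) := inferInstanceAs (CommRing (G → k))

/-- The constants are the constant functions. -/
instance : Algebra k (FunctionHopf k G) := inferInstanceAs (Algebra k (G → k))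

variable {k G}

/-- The function `e g` that is `1` at `g` and `0` elsewhere. -/
def e [DecidableEq G] (g : G) : FunctionHopf k G := fun h => if h = g then 1 else 0

variable (k)

/-- Evaluation at `g`, as a linear form. -/
def eval (g : G) : FunctionHopf k G →ₗ[k] k := LinearMap.proj (φ := fun _ : G => k) g

variable {k}

theorem eval_apply (g : G) (f : FunctionHopf k G) : eval k g f = f g := rfl

theorem eval_e [DecidableEq G] (g h : G) :
    eval k g (e h : FunctionHopf k G) = if g = h then 1 else 0 := rfl

theorem e_mul_e [DecidableEq G] (g h : G) :
    (e g : FunctionHopf k G) * e h = if g = h then e g else 0 := by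
  funext x
  change (if x = g then (1 : k) else 0) * (if x = h then 1 else 0) =
    (if g = h then e g else 0 : FunctionHopf k G) x
  by_cases hgh : g = h
  · subst hgh
    by_cases hx : x = g <;> simp [hx, e]
  · rw [if_neg hgh]
    by_cases hx : x = g
    · subst hx
      simp only [if_neg hgh, mul_zero]
      rfl
    · simp only [if_neg hx, zero_mul]
      rfl

variable [Fintype G] [DecidableEq G]

theorem sum_smul_e (f : FunctionHopf k G) : ∑ g, f g • (e g : FunctionHopf k G) = f := by
  funext x
  have : eval k x (∑ g, f g • (e g : FunctionHopf k G)) = f x := by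
    simp only [map_sum, map_smul, eval_e, smul_eq_mul, mul_ite, mul_one, mul_zero]
    exact Fintype.sum_ite_eq x fun g => eval k g f
  exact this

theorem sum_e : ∑ g, (e g : FunctionHopf k G) = 1 := by
  have h := sum_smul_e (1 : FunctionHopf k G)
  rw [← h]
  refine Finset.sum_congr rfl fun g _ => ?_
  change _ = (1 : k) • _
  rw [one_smul]

theorem linearMap_ext {M : Type*} [AddCommMonoid M] [Module k M]
    {φ ψ : FunctionHopf k G →ₗ[k] M} (h : ∀ g, φ (e g) = ψ (e g)) : φ = ψ := by
  ext f
  rw [← sum_smul_e f]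
  simp [map_sum, h]

instance : Module.Finite k (FunctionHopf k G) := inferInstanceAs (Module.Finite k (G → k))

end Algebra

section Hopf

variable (k G : Type*) [Field k] [Group G] [Fintype G] [DecidableEq G]

/-- The coproduct `e g ↦ ∑ h, e (g h⁻¹) ⊗ e h`, the counit `f ↦ f 1`. -/
instance : CoalgebraStruct k (FunctionHopf k G) where
  comul := ∑ g : G, (eval k g).smulRight (∑ h : G, e (g * h⁻¹) ⊗ₜ[k] e h)
  counit := eval k 1

variable {k G}

theorem comul_e (g : G) :
    comul (R := k) (e g : FunctionHopf k G) = ∑ h : G, e (g * h⁻¹) ⊗ₜ[k] e h := by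
  change (∑ g' : G, (eval k g').smulRight (∑ h : G, e (g' * h⁻¹) ⊗ₜ[k] e h)) (e g) = _
  simp [LinearMap.sum_apply, eval_e]

theorem counit_e (g : G) :
    counit (R := k) (e g : FunctionHopf k G) = if g = 1 then 1 else 0 := by
  change eval k 1 (e g) = _
  simp [eval_e, eq_comm]

theorem counit_apply (f : FunctionHopf k G) : counit (R := k) f = f 1 := rfl

variable (k G)

instance : Coalgebra k (FunctionHopf k G) where
  coassoc := by
    refine linearMap_ext fun g => ?_
    simp only [LinearMap.comp_apply, comul_e, map_sum, LinearMap.rTensor_tmul,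
      LinearMap.lTensor_tmul, TensorProduct.sum_tmul, TensorProduct.tmul_sum,
      LinearEquiv.coe_coe, TensorProduct.assoc_tmul]
    conv_rhs => rw [Finset.sum_comm]
    refine Finset.sum_congr rfl fun a _ => ?_
    refine (Fintype.sum_equiv (Equiv.mulRight a⁻¹) _ _ fun h => ?_).symm
    simp [mul_assoc]
  rTensor_counit_comp_comul := by
    refine linearMap_ext fun g => ?_
    simp only [LinearMap.comp_apply, comul_e, map_sum, LinearMap.rTensor_tmul, counit_e]
    rw [Finset.sum_eq_single g]
    · simp
    · intro h _ hh
      rw [if_neg, TensorProduct.zero_tmul]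
      rw [mul_inv_eq_one]
      exact fun h' => hh h'.symm
    · simp
  lTensor_counit_comp_comul := by
    refine linearMap_ext fun g => ?_
    simp only [LinearMap.comp_apply, comul_e, map_sum, LinearMap.lTensor_tmul, counit_e]
    rw [Finset.sum_eq_single 1]
    · simp
    · intro h _ hh
      rw [if_neg hh, TensorProduct.tmul_zero]
    · simp

theorem comul_mul' (a b : FunctionHopf k G) :
    comul (R := k) (a * b) = comul (R := k) a * comul (R := k) b := by
  suffices H : (LinearMap.mul k (FunctionHopf k G)).compr₂ comul =
      (LinearMap.mul k (FunctionHopf k G ⊗[k] FunctionHopf k G)).compl₁₂ comul comul from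
    LinearMap.congr_fun₂ H a b
  refine linearMap_ext fun g => linearMap_ext fun h => ?_
  simp only [LinearMap.compr₂_apply, LinearMap.compl₁₂_apply, LinearMap.mul_apply', e_mul_e,
    comul_e, Finset.sum_mul_sum, Algebra.TensorProduct.tmul_mul_tmul]
  by_cases hgh : g = h
  · subst hgh
    simp only [if_true, comul_e]
    refine Finset.sum_congr rfl fun x _ => ?_
    rw [Finset.sum_eq_single x]
    · simp
    · intro y _ hy
      rw [if_neg (Ne.symm hy), TensorProduct.tmul_zero]
    · simp
  · rw [if_neg hgh, map_zero]
    symm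
    refine Finset.sum_eq_zero fun x _ => Finset.sum_eq_zero fun y _ => ?_
    by_cases hxy : x = y
    · subst hxy
      rw [if_neg, TensorProduct.zero_tmul]
      exact fun h' => hgh (mul_right_cancel h')
    · rw [if_neg hxy, TensorProduct.tmul_zero]

instance : Bialgebra k (FunctionHopf k G) :=
  Bialgebra.mk' k (FunctionHopf k G)
    (counit_one := rfl)
    (counit_mul := rfl)
    (comul_one := by
      rw [← sum_e, map_sum]
      simp only [comul_e]
      rw [Finset.sum_comm, Algebra.TensorProduct.one_def, ← sum_e, TensorProduct.tmul_sum]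
      refine Finset.sum_congr rfl fun h _ => ?_
      rw [← TensorProduct.sum_tmul]
      congr 1
      exact Fintype.sum_equiv (Equiv.mulRight h⁻¹) _ _ fun _ => rfl)
    (comul_mul := comul_mul' k G _ _)

/-- The antipode `f ↦ (g ↦ f g⁻¹)`. -/
instance : HopfAlgebraStruct k (FunctionHopf k G) where
  antipode := (LinearMap.funLeft k k (fun g : G => g⁻¹) : (G → k) →ₗ[k] (G → k))

variable {k G}

theorem antipode_e (g : G) :
    HopfAlgebraStruct.antipode k (e g : FunctionHopf k G) = e g⁻¹ := by
  funext x
  change (if x⁻¹ = g then (1 : k) else 0) = if x = g⁻¹ then 1 else 0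
  simp only [inv_eq_iff_eq_inv]

variable (k G)

instance : HopfAlgebra k (FunctionHopf k G) where
  mul_antipode_rTensor_comul := by
    refine linearMap_ext fun g => ?_
    simp only [LinearMap.comp_apply, comul_e, map_sum, LinearMap.rTensor_tmul, antipode_e,
      LinearMap.mul'_apply, e_mul_e, counit_e, Algebra.linearMap_apply]
    by_cases hg : g = 1
    · subst hg
      simp [sum_e]
    · simp [hg]
  mul_antipode_lTensor_comul := by
    refine linearMap_ext fun g => ?_
    simp only [LinearMap.comp_apply, comul_e, map_sum, LinearMap.lTensor_tmul, antipode_e,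
      LinearMap.mul'_apply, e_mul_e, counit_e, Algebra.linearMap_apply]
    by_cases hg : g = 1
    · subst hg
      simp only [one_mul, if_true, map_one]
      rw [← sum_e]
      exact Fintype.sum_equiv (Equiv.inv G) _ _ fun _ => rfl
    · simp [hg]

end Hopf

end FunctionHopf

/-! ### The free commutative Hopf algebra on a coalgebra and the generic base algebra -/

section Coalg

variable (k C : Type*) [Field k] [AddCommGroup C] [Module k C]

/-- The field of fractions `Frac S(t_C)` of the symmetric algebra of the vector space `C`. -/
abbrev FracSym : Type _ := FractionRing (SymmetricAlgebra k C)

/-- The linear map `x ↦ t_x` from `C` to `Frac S(t_C)`. -/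
def t : C →ₗ[k] FracSym k C :=
  (IsScalarTower.toAlgHom k (SymmetricAlgebra k C) (FracSym k C)).toLinearMap ∘ₗ
    SymmetricAlgebra.ι k C

variable [Coalgebra k C]

/-- The linear map `x ↦ t⁻¹_x` from `C` to `Frac S(t_C)`: the inverse of `t` for the convolution
product of linear maps, that is, the unique linear map with
`t_{x₁} t⁻¹_{x₂} = t⁻¹_{x₁} t_{x₂} = ε(x) 1`. -/
def tInv : C →ₗ[k] FracSym k C := (Ring.inverse (WithConv.toConv (t k C))).ofConv

theorem exists_solution {n : Type*} [Fintype n] [DecidableEq n] (b : n → C)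
    (c : n → n → n → k)
    (hc : ∀ j l, ∑ i, c j i l * counit (R := k) (b i) = if j = l then 1 else 0) :
    ∃ v : n → FracSym k C, ∀ j, ∑ i, ∑ l, c j i l • (t k C (b i) * v l) =
      algebraMap k (FracSym k C) (counit (R := k) (b j)) := by
  let M : Matrix n n (SymmetricAlgebra k C) :=
    Matrix.of fun j l => ∑ i, c j i l • SymmetricAlgebra.ι k C (b i)
  let N : Matrix n n (FracSym k C) := (algebraMap (SymmetricAlgebra k C) (FracSym k C)).mapMatrix M
  have hM : (SymmetricAlgebra.lift (counit (R := k) (A := C))).toRingHom.mapMatrix M = 1 := by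
    ext j l
    simp [M, Matrix.one_apply, map_sum, hc]
  have hdet : M.det ≠ 0 := by
    intro h0
    have h1 := congrArg Matrix.det hM
    rw [← RingHom.map_det, h0, map_zero, Matrix.det_one] at h1
    exact zero_ne_one h1
  have hN : IsUnit N.det := by
    rw [isUnit_iff_ne_zero, ← RingHom.map_det]
    exact fun h => hdet ((FaithfulSMul.algebraMap_injective _ (FracSym k C)) (by rw [h, map_zero]))
  let u : n → FracSym k C := fun j => algebraMap k (FracSym k C) (counit (R := k) (b j))
  refine ⟨N⁻¹.mulVec u, fun j => ?_⟩
  have h : N.mulVec (N⁻¹.mulVec u) = u := by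
    rw [Matrix.mulVec_mulVec, Matrix.mul_nonsing_inv _ hN, Matrix.one_mulVec]
  have hNe (j l : n) : N j l = ∑ i, c j i l • t k C (b i) := by
    simp only [N, M, RingHom.mapMatrix_apply, Matrix.map_apply, Matrix.of_apply, map_sum]
    refine Finset.sum_congr rfl fun i _ => ?_
    exact map_smul (IsScalarTower.toAlgHom k (SymmetricAlgebra k C) (FracSym k C)) _ _
  refine Eq.trans ?_ (congrFun h j)
  rw [Finset.sum_comm]
  simp only [Matrix.mulVec, dotProduct, hNe, Finset.sum_mul, smul_mul_assoc]

/-- If `C` is finite-dimensional, then the convolution inverse of `t` exists. -/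
theorem isUnit_t [Module.Finite k C] : IsUnit (WithConv.toConv (t k C)) := by
  let b := Module.finBasis k C
  let c := fun j i l => (b.tensorProduct b).repr (comul (R := k) (b j)) (i, l)
  have hb (j) : comul (R := k) (b j) = ∑ i, ∑ l, c j i l • (b i ⊗ₜ[k] b l) := by
    conv_lhs => rw [← (b.tensorProduct b).sum_repr (comul (R := k) (b j))]
    rw [Fintype.sum_prod_type]
    simp [c]
  have hc1 (j l) : ∑ i, c j i l * counit (R := k) (b i) = if j = l then 1 else 0 := by
    have h := Coalgebra.rTensor_counit_comul (R := k) (b j)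
    rw [hb] at h
    have h' := congrArg (fun z => b.repr (TensorProduct.lid k C z) l) h
    simpa [map_sum, Finsupp.single_apply, Finset.sum_ite_eq] using h'
  have hc2 (j l) : ∑ i, c j l i * counit (R := k) (b i) = if j = l then 1 else 0 := by
    have h := Coalgebra.lTensor_counit_comul (R := k) (b j)
    rw [hb] at h
    have h' := congrArg (fun z => b.repr (TensorProduct.rid k C z) l) h
    simpa [map_sum, Finsupp.single_apply, Finset.sum_ite_eq] using h'
  obtain ⟨v, hv⟩ := exists_solution k C b c hc1
  obtain ⟨w, hw⟩ := exists_solution k C b (fun j i l => c j l i) hc2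
  refine isUnit_iff_exists_and_exists.2
    ⟨⟨WithConv.toConv (b.constr k v), ?_⟩, ⟨WithConv.toConv (b.constr k w), ?_⟩⟩
  · refine WithConv.ext (b.ext fun j => ?_)
    refine Eq.trans ?_ (hv j)
    rw [LinearMap.convMul_apply, hb]
    simp [map_sum]
  · refine WithConv.ext (b.ext fun j => ?_)
    refine Eq.trans ?_ (hw j)
    rw [LinearMap.convMul_apply, hb, Finset.sum_comm]
    simp [map_sum, mul_comm]

/-- The defining identities of `t⁻¹`, as identities of convolution products. -/
theorem t_conv_tInv [Module.Finite k C] :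
    WithConv.toConv (t k C) * WithConv.toConv (tInv k C) = 1 ∧
      WithConv.toConv (tInv k C) * WithConv.toConv (t k C) = 1 :=
  ⟨Ring.mul_inverse_cancel _ (isUnit_t k C), Ring.inverse_mul_cancel _ (isUnit_t k C)⟩

/-- The algebra `S(t_C)_Θ`: the subalgebra of `Frac S(t_C)` generated by all `t_x`, `t⁻¹_x`. -/
def freeCommHopf : Subalgebra k (FracSym k C) :=
  Algebra.adjoin k (Set.range (t k C) ∪ Set.range (tInv k C))

end Coalg

section GenericBaseAlgebra

variable (k H : Type*) [Field k] [Ring H] [HopfAlgebra k H]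

/-- The linear map `x ⊗ y ↦ t_x t_y` on `H ⊗ H`. -/
def tt : H ⊗[k] H →ₗ[k] FracSym k H :=
  LinearMap.mul' k (FracSym k H) ∘ₗ TensorProduct.map (t k H) (t k H)

/-- The linear map `x ⊗ y ↦ t⁻¹_x t⁻¹_y` on `H ⊗ H`. -/
def ttInv : H ⊗[k] H →ₗ[k] FracSym k H :=
  LinearMap.mul' k (FracSym k H) ∘ₗ TensorProduct.map (tInv k H) (tInv k H)

/-- The linear map `x ⊗ y ↦ σ(x,y) = t_{x₁} t_{y₁} t⁻¹_{x₂ y₂}`: the convolution product of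
`x ⊗ y ↦ t_x t_y` and `x ⊗ y ↦ t⁻¹_{xy}` on the coalgebra `H ⊗ H`, whose coproduct sends
`x ⊗ y` to `(x₁ ⊗ y₁) ⊗ (x₂ ⊗ y₂)`. -/
def sigma : H ⊗[k] H →ₗ[k] FracSym k H :=
  (WithConv.toConv (tt k H) * WithConv.toConv (tInv k H ∘ₗ LinearMap.mul' k H)).ofConv

/-- The linear map `x ⊗ y ↦ σ⁻¹(x,y) = t_{x₁ y₁} t⁻¹_{x₂} t⁻¹_{y₂}`. -/
def sigmaInv : H ⊗[k] H →ₗ[k] FracSym k H :=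
  (WithConv.toConv (t k H ∘ₗ LinearMap.mul' k H) * WithConv.toConv (ttInv k H)).ofConv

/-- The generic base algebra `B_H`, generated by all `σ(x,y)` and `σ⁻¹(x,y)`.  (It is contained
in `S(t_H)_Θ`, see `genericBase_le`.) -/
def genericBase : Subalgebra k (FracSym k H) :=
  Algebra.adjoin k
    ({z | ∃ x y : H, z = sigma k H (x ⊗ₜ y)} ∪ {z | ∃ x y : H, z = sigmaInv k H (x ⊗ₜ y)})

theorem sigma_tmul (x y : H) :
    sigma k H (x ⊗ₜ y) = ∑ i ∈ (ℛ k x).index, ∑ j ∈ (ℛ k y).index,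
      t k H ((ℛ k x).left i) * t k H ((ℛ k y).left j) *
        tInv k H ((ℛ k x).right i * (ℛ k y).right j) := by
  conv_lhs => rw [sigma, LinearMap.convMul_apply, TensorProduct.comul_tmul,
    ← (ℛ k x).eq, ← (ℛ k y).eq]
  simp only [TensorProduct.sum_tmul, TensorProduct.tmul_sum, map_sum, tt,
    TensorProduct.AlgebraTensorModule.tensorTensorTensorComm_tmul, TensorProduct.map_tmul,
    LinearMap.comp_apply, LinearMap.mul'_apply]
  exact Finset.sum_comm

theorem sigmaInv_tmul (x y : H) :
    sigmaInv k H (x ⊗ₜ y) = ∑ i ∈ (ℛ k x).index, ∑ j ∈ (ℛ k y).index,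
      t k H ((ℛ k x).left i * (ℛ k y).left j) *
        (tInv k H ((ℛ k x).right i) * tInv k H ((ℛ k y).right j)) := by
  conv_lhs => rw [sigmaInv, LinearMap.convMul_apply, TensorProduct.comul_tmul,
    ← (ℛ k x).eq, ← (ℛ k y).eq]
  simp only [TensorProduct.sum_tmul, TensorProduct.tmul_sum, map_sum, ttInv,
    TensorProduct.AlgebraTensorModule.tensorTensorTensorComm_tmul, TensorProduct.map_tmul,
    LinearMap.comp_apply, LinearMap.mul'_apply]
  exact Finset.sum_comm

theorem genericBase_le : genericBase k H ≤ freeCommHopf k H := by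
  have ht (x : H) : t k H x ∈ freeCommHopf k H :=
    Algebra.subset_adjoin (Or.inl ⟨x, rfl⟩)
  have ht' (x : H) : tInv k H x ∈ freeCommHopf k H :=
    Algebra.subset_adjoin (Or.inr ⟨x, rfl⟩)
  refine Algebra.adjoin_le ?_
  rintro _ (⟨x, y, rfl⟩ | ⟨x, y, rfl⟩)
  · rw [sigma_tmul]
    exact sum_mem fun i _ => sum_mem fun j _ => mul_mem (mul_mem (ht _) (ht _)) (ht' _)
  · rw [sigmaInv_tmul]
    exact sum_mem fun i _ => sum_mem fun j _ => mul_mem (ht _) (mul_mem (ht' _) (ht' _))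

end GenericBaseAlgebra

/-! ### The universal comodule algebra and its coinvariants -/

section Coinvariants

variable {k A H : Type*} [Field k] [Ring A] [Algebra k A] [Ring H] [Algebra k H]

/-- The subalgebra `{a | δ a = a ⊗ 1}` of coinvariants of a coaction `δ : A → A ⊗ H`. -/
def coinvariants (δ : A →ₐ[k] A ⊗[k] H) : Subalgebra k A :=
  AlgHom.equalizer δ Algebra.TensorProduct.includeLeft

theorem mem_coinvariants (δ : A →ₐ[k] A ⊗[k] H) (a : A) :
    a ∈ coinvariants δ ↔ δ a = a ⊗ₜ 1 := Iff.rfl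

end Coinvariants

section Universal

variable (k H : Type*) [Field k] [Ring H] [HopfAlgebra k H]

/-- The coaction `X_x ↦ X_{x₁} ⊗ x₂` on the tensor algebra `T(X_H)`. -/
def deltaT : TensorAlgebra k H →ₐ[k] TensorAlgebra k H ⊗[k] H :=
  TensorAlgebra.lift k (TensorProduct.map (TensorAlgebra.ι k) LinearMap.id ∘ₗ comul)

/-- The algebra map `μ : T(X_H) → S(t_H) ⊗ H`, `X_x ↦ t_{x₁} ⊗ x₂`. -/
def mu : TensorAlgebra k H →ₐ[k] SymmetricAlgebra k H ⊗[k] H :=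
  TensorAlgebra.lift k (TensorProduct.map (SymmetricAlgebra.ι k H) LinearMap.id ∘ₗ comul)

/-- The ideal `I_H = ker μ` of identities. -/
abbrev identities : Ideal (TensorAlgebra k H) := RingHom.ker (mu k H)

/-- The universal comodule algebra `U_H = T(X_H) / I_H`. -/
abbrev Universal : Type _ := TensorAlgebra k H ⧸ identities k H

/-- The injection `U_H → S(t_H) ⊗ H` induced by `μ`. -/
def muBar : Universal k H →ₐ[k] SymmetricAlgebra k H ⊗[k] H :=
  Ideal.Quotient.liftₐ (identities k H) (mu k H) fun _ h => h

theorem muBar_mk (P : TensorAlgebra k H) :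
    muBar k H (Ideal.Quotient.mkₐ k (identities k H) P) = mu k H P := rfl

theorem muBar_injective : Function.Injective (muBar k H) := by
  rw [injective_iff_map_eq_zero]
  intro u hu
  obtain ⟨P, rfl⟩ := Ideal.Quotient.mkₐ_surjective k (identities k H) u
  exact Ideal.Quotient.eq_zero_iff_mem.2 hu

/-- `μ` is a comodule algebra map, for the coaction `id ⊗ Δ` on `S(t_H) ⊗ H`. -/
theorem mu_comodule :
    ((Algebra.TensorProduct.assoc k k k (SymmetricAlgebra k H) H H).toAlgHom.comp
      (Algebra.TensorProduct.map (mu k H) (AlgHom.id k H))).comp (deltaT k H) =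
    (Algebra.TensorProduct.map (AlgHom.id k (SymmetricAlgebra k H))
      (Bialgebra.comulAlgHom k H)).comp (mu k H) := by
  refine TensorAlgebra.hom_ext (LinearMap.ext fun x => ?_)
  have hT : deltaT k H (TensorAlgebra.ι k x) =
      TensorProduct.map (TensorAlgebra.ι k) LinearMap.id (comul (R := k) x) := by
    simp [deltaT]
  have hm (y : H) : mu k H (TensorAlgebra.ι k y) =
      TensorProduct.map (SymmetricAlgebra.ι k H) LinearMap.id (comul (R := k) y) := by
    simp [mu]
  have h1 (z : H ⊗[k] H) :
      TensorProduct.assoc k (SymmetricAlgebra k H) H H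
        (Algebra.TensorProduct.map (mu k H) (AlgHom.id k H)
          (TensorProduct.map (TensorAlgebra.ι k) LinearMap.id z)) =
      TensorProduct.map (SymmetricAlgebra.ι k H) LinearMap.id
        (TensorProduct.assoc k H H H (comul.rTensor H z)) := by
    induction z with
    | zero => simp
    | add a b ha hb => simp only [map_add, ha, hb]
    | tmul a b =>
      simp only [TensorProduct.map_tmul, Algebra.TensorProduct.map_tmul, hm, LinearMap.id_apply,
        AlgHom.id_apply, LinearMap.rTensor_tmul]
      generalize comul (R := k) a = w
      induction w with
      | zero => simp
      | add c d hc hd => simp only [map_add, TensorProduct.add_tmul, hc, hd]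
      | tmul c d => simp
  have h2 (z : H ⊗[k] H) :
      Algebra.TensorProduct.map (AlgHom.id k (SymmetricAlgebra k H)) (Bialgebra.comulAlgHom k H)
        (TensorProduct.map (SymmetricAlgebra.ι k H) LinearMap.id z) =
      TensorProduct.map (SymmetricAlgebra.ι k H) LinearMap.id (comul.lTensor H z) := by
    induction z with
    | zero => simp
    | add a b ha hb => simp only [map_add, ha, hb]
    | tmul a b => simp
  change TensorProduct.assoc k (SymmetricAlgebra k H) H H
      (Algebra.TensorProduct.map (mu k H) (AlgHom.id k H) (deltaT k H (TensorAlgebra.ι k x))) =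
    Algebra.TensorProduct.map (AlgHom.id k (SymmetricAlgebra k H)) (Bialgebra.comulAlgHom k H)
      (mu k H (TensorAlgebra.ι k x))
  rw [hT, hm, h1, h2, Coalgebra.coassoc_apply]

theorem map_muBar (z : TensorAlgebra k H ⊗[k] H) :
    Algebra.TensorProduct.map (muBar k H) (AlgHom.id k H)
      (Algebra.TensorProduct.map (Ideal.Quotient.mkₐ k (identities k H)) (AlgHom.id k H) z) =
    Algebra.TensorProduct.map (mu k H) (AlgHom.id k H) z := by
  induction z with
  | zero => simp
  | add a b ha hb => simp only [map_add, ha, hb]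
  | tmul a b => simp only [Algebra.TensorProduct.map_tmul, muBar_mk, AlgHom.id_apply]

theorem deltaU_aux (P : TensorAlgebra k H) (hP : P ∈ identities k H) :
    ((Algebra.TensorProduct.map (Ideal.Quotient.mkₐ k (identities k H)) (AlgHom.id k H)).comp
      (deltaT k H)) P = 0 := by
  have hinj : Function.Injective
      (Algebra.TensorProduct.map (muBar k H) (AlgHom.id k H)) :=
    Module.Flat.rTensor_preserves_injective_linearMap (M := H) (muBar k H).toLinearMap
      (muBar_injective k H)
  apply hinj
  rw [map_zero, AlgHom.comp_apply, map_muBar]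
  apply (TensorProduct.assoc k (SymmetricAlgebra k H) H H).injective
  rw [map_zero]
  refine (AlgHom.congr_fun (mu_comodule k H) P).trans ?_
  rw [AlgHom.comp_apply, RingHom.mem_ker.1 hP, map_zero]

/-- The coaction on `U_H` induced by the coaction on `T(X_H)`. -/
def deltaU : Universal k H →ₐ[k] Universal k H ⊗[k] H :=
  Ideal.Quotient.liftₐ (identities k H)
    ((Algebra.TensorProduct.map (Ideal.Quotient.mkₐ k (identities k H)) (AlgHom.id k H)).comp
      (deltaT k H))
    (deltaU_aux k H)

theorem deltaU_mk (P : TensorAlgebra k H) :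
    deltaU k H (Ideal.Quotient.mkₐ k (identities k H) P) =
      Algebra.TensorProduct.map (Ideal.Quotient.mkₐ k (identities k H)) (AlgHom.id k H)
        (deltaT k H P) := rfl

/-- The algebra `V_H` of coinvariants of the universal comodule algebra. -/
def universalCoinvariants : Subalgebra k (Universal k H) := coinvariants (deltaU k H)

/-- The algebra map `V_H → S(t_H)`, `v ↦ (id ⊗ ε)(μ̄ v)`.  By `muBar_eq_tmul_one`, it is `μ̄`
followed by the identification `S(t_H) ⊗ 1 = S(t_H)`. -/
def toSym : universalCoinvariants k H →ₐ[k] SymmetricAlgebra k H :=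
  ((Algebra.TensorProduct.rid k k (SymmetricAlgebra k H)).toAlgHom.comp
    (Algebra.TensorProduct.map (AlgHom.id k (SymmetricAlgebra k H))
      (Bialgebra.counitAlgHom k H))).comp
    ((muBar k H).comp (universalCoinvariants k H).val)

theorem muBar_eq_tmul_one (v : universalCoinvariants k H) :
    muBar k H v = toSym k H v ⊗ₜ 1 := by
  have h4 (z : SymmetricAlgebra k H ⊗[k] H) :
      (TensorProduct.lid k H).toLinearMap.lTensor (SymmetricAlgebra k H)
        (((counit (R := k)).rTensor H).lTensor (SymmetricAlgebra k H)
          ((comul (R := k)).lTensor (SymmetricAlgebra k H) z)) = z := by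
    induction z with
    | zero => simp
    | add a b ha hb => simp only [map_add, ha, hb]
    | tmul a b => simp
  have h5 (z : SymmetricAlgebra k H ⊗[k] H) :
      (TensorProduct.lid k H).toLinearMap.lTensor (SymmetricAlgebra k H)
        (((counit (R := k)).rTensor H).lTensor (SymmetricAlgebra k H)
          (TensorProduct.assoc k (SymmetricAlgebra k H) H H (z ⊗ₜ 1))) =
      (TensorProduct.rid k (SymmetricAlgebra k H)
        ((counit (R := k)).lTensor (SymmetricAlgebra k H) z)) ⊗ₜ 1 := by
    induction z with
    | zero => simp
    | add a b ha hb => simp only [map_add, TensorProduct.add_tmul, ha, hb]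
    | tmul a b => simp [TensorProduct.smul_tmul]
  obtain ⟨v, hv⟩ := v
  obtain ⟨P, rfl⟩ := Ideal.Quotient.mkₐ_surjective k (identities k H) v
  have h0 := (mem_coinvariants (deltaU k H) _).1 hv
  rw [deltaU_mk] at h0
  have h1 := congrArg (Algebra.TensorProduct.map (muBar k H) (AlgHom.id k H)) h0
  rw [map_muBar, Algebra.TensorProduct.map_tmul, muBar_mk, map_one] at h1
  have h2 := AlgHom.congr_fun (mu_comodule k H) P
  change TensorProduct.assoc k (SymmetricAlgebra k H) H H
      (Algebra.TensorProduct.map (mu k H) (AlgHom.id k H) (deltaT k H P)) =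
    (comul (R := k)).lTensor (SymmetricAlgebra k H) (mu k H P) at h2
  rw [h1] at h2
  have h3 := congrArg ((TensorProduct.lid k H).toLinearMap.lTensor (SymmetricAlgebra k H))
    (congrArg (((counit (R := k)).rTensor H).lTensor (SymmetricAlgebra k H)) h2)
  change muBar k H (Ideal.Quotient.mkₐ k (identities k H) P) =
    (TensorProduct.rid k (SymmetricAlgebra k H)
      ((counit (R := k)).lTensor (SymmetricAlgebra k H) (mu k H P))) ⊗ₜ 1
  rw [muBar_mk]
  rw [h4] at h3
  exact h3.symm.trans (h5 _)

theorem toSym_injective : Function.Injective (toSym k H) := by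
  intro v w h
  apply Subtype.ext
  apply muBar_injective k H
  rw [muBar_eq_tmul_one, muBar_eq_tmul_one, h]

/-- The algebra `V_H`, identified with its image `μ̄(V_H)` in `S(t_H) = S(t_H) ⊗ 1`, and regarded
as a subalgebra of `Frac S(t_H)`. -/
def universalCoinvariantsImage : Subalgebra k (FracSym k H) :=
  ((IsScalarTower.toAlgHom k (SymmetricAlgebra k H) (FracSym k H)).comp (toSym k H)).range

end Universal

/-- The algebra `B` is a localization of its subalgebra `A`: one has `A ⊆ B`, and the inclusion
is the localization of `A` at some multiplicative subset `M` of `A`. -/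
def IsLocalizationOf {k F : Type*} [Field k] [Field F] [Algebra k F]
    (B A : Subalgebra k F) : Prop :=
  ∃ h : A ≤ B, ∃ M : Submonoid A,
    @IsLocalization A _ M B _ (Subalgebra.inclusion h).toRingHom.toAlgebra

end GenericBase

end

/-! Write `t_g` and `t⁻¹_g` for the values of `t` and `t⁻¹` at the basis function `e g`. The group
`G` acts on `S(t_H)` and its fraction field by `t_g ↦ t_{g x⁻¹}`, and hence `t⁻¹_g ↦ t⁻¹_{x g}`. A
coaction of `O_k(G)` is an action of `G`, so `V_H` is the ring of invariants of `S(t_H)`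
(`mem_range_toSym_iff`). The elements `σ` and `σ⁻¹` are also invariant, so everything in `B_H` is
invariant; the question is which invariants lie in `B_H`.

Inverting the convolution that defines `σ` gives `t_x t_y = σ(x₁,y₁) t_{x₂y₂}`. So the `B_H`-span of
the `t_g` is closed under products. It contains `1`, because `∑ t_g` and its inverse `∑ t⁻¹_g` lie
in `B_H`. Hence the span contains `S(t_H)`. The trace of each `t_g` over `G` is `∑ t_g ∈ B_H`, so
the trace maps the span into `B_H`. On an invariant the trace is multiplication by `|G|`, which is
invertible in `k`; therefore `V_H ⊆ B_H`. The same argument with `σ⁻¹` puts every invariant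
polynomial in the `t⁻¹_g` into `B_H`.

The denominators are powers of the group determinant `D = det (t_{g h⁻¹})`. The action multiplies
`D` by signs, so `D²` lies in `V_H`. As `D⁻¹ = det (t⁻¹_{g h⁻¹})`, the element `D⁻²` is an invariant
polynomial in the `t⁻¹_g`, so it lies in `B_H`. By Cramer's rule `D t⁻¹_g ∈ S(t_H)`, so a power of
`D²` carries each element of `B_H` into `S(t_H)`, and by invariance into `V_H`. Thus `B_H =
V_H[D⁻²]`. -/

noncomputable section

namespace GenericBase

open FunctionHopf

/-! ### The translation action of `G` on `S(t_H)` and its fraction field -/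

section Translation

variable (k : Type*) {G : Type*} [Field k] [Group G]

/-- Translation of functions, `f ↦ (y ↦ f (y * x))`. -/
def translate (x : G) : FunctionHopf k G →ₗ[k] FunctionHopf k G :=
  (LinearMap.funLeft k k (fun y : G => y * x) : (G → k) →ₗ[k] (G → k))

theorem translate_translate (x y : G) (f : FunctionHopf k G) :
    translate k x (translate k y f) = translate k (x * y) f := by
  funext z
  exact congrArg f (mul_assoc z x y)

theorem translate_one (f : FunctionHopf k G) : translate k 1 f = f := by
  funext z
  exact congrArg f (mul_one z)

theorem translate_e [DecidableEq G] (x g : G) :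
    translate k x (e g : FunctionHopf k G) = e (g * x⁻¹) := by
  funext z
  change (if z * x = g then (1 : k) else 0) = if z = g * x⁻¹ then 1 else 0
  simp only [eq_mul_inv_iff_mul_eq]

/-- The algebra map on `S(t_H)` induced by translation: `t_g ↦ t_{g x⁻¹}`. -/
def symTranslateHom (x : G) :
    SymmetricAlgebra k (FunctionHopf k G) →ₐ[k] SymmetricAlgebra k (FunctionHopf k G) :=
  SymmetricAlgebra.lift (SymmetricAlgebra.ι k (FunctionHopf k G) ∘ₗ translate k x)

theorem symTranslateHom_ι (x : G) (f : FunctionHopf k G) :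
    symTranslateHom k x (SymmetricAlgebra.ι k _ f) = SymmetricAlgebra.ι k _ (translate k x f) := by
  simp [symTranslateHom]

theorem symTranslateHom_comp (x y : G) :
    (symTranslateHom k x).comp (symTranslateHom k y) = symTranslateHom k (x * y) := by
  refine SymmetricAlgebra.algHom_ext (LinearMap.ext fun f => ?_)
  simp [symTranslateHom_ι, translate_translate]

theorem symTranslateHom_one :
    symTranslateHom k (1 : G) = AlgHom.id k _ := by
  refine SymmetricAlgebra.algHom_ext (LinearMap.ext fun f => ?_)
  simp [symTranslateHom_ι, translate_one]

/-- The action of `x` on `S(t_H)`, `t_g ↦ t_{g x⁻¹}`. -/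
def symTranslate (x : G) :
    SymmetricAlgebra k (FunctionHopf k G) ≃ₐ[k] SymmetricAlgebra k (FunctionHopf k G) :=
  AlgEquiv.ofAlgHom (symTranslateHom k x) (symTranslateHom k x⁻¹)
    (by rw [symTranslateHom_comp, mul_inv_cancel, symTranslateHom_one])
    (by rw [symTranslateHom_comp, inv_mul_cancel, symTranslateHom_one])

/-- The action of `x` on `Frac S(t_H)`. -/
def fracTranslate (x : G) : FracSym k (FunctionHopf k G) ≃ₐ[k] FracSym k (FunctionHopf k G) :=
  IsFractionRing.fieldEquivOfAlgEquiv k _ _ (symTranslate k x)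

theorem fracTranslate_algebraMap (x : G) (s : SymmetricAlgebra k (FunctionHopf k G)) :
    fracTranslate k x (algebraMap _ _ s) = algebraMap _ _ (symTranslateHom k x s) :=
  IsFractionRing.fieldEquivOfAlgEquiv_algebraMap _ _ _ _ _

theorem fracTranslate_t [DecidableEq G] (x g : G) :
    fracTranslate k x (t k (FunctionHopf k G) (e g)) = t k (FunctionHopf k G) (e (g * x⁻¹)) := by
  refine (fracTranslate_algebraMap k x _).trans ?_
  rw [symTranslateHom_ι, translate_e]
  rfl

end Translation

/-! ### Coinvariants of `U_H` as translation invariants of `S(t_H)` -/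

section Coinvariants

variable (k G : Type*) [Field k] [Group G] [Fintype G] [DecidableEq G]

local notation "H" => FunctionHopf k G
local notation "S" => SymmetricAlgebra k (FunctionHopf k G)

/-- The algebra map `S(t_H) → S(t_H) ⊗ H`, `t_x ↦ t_{x₁} ⊗ x₂`. -/
def symCoaction : S →ₐ[k] S ⊗[k] H :=
  SymmetricAlgebra.lift (TensorProduct.map (SymmetricAlgebra.ι k H) LinearMap.id ∘ₗ comul)

/-- Since `O_k(G)` is commutative, so is `S(t_H) ⊗ H`, and `μ` factors through symmetrization. -/
theorem mu_eq_symCoaction (P : TensorAlgebra k H) :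
    mu k H P = symCoaction k G (SymmetricAlgebra.algHom k H P) := by
  suffices h : mu k H = (symCoaction k G).comp (SymmetricAlgebra.algHom k H) from
    DFunLike.congr_fun h P
  refine TensorAlgebra.hom_ext (LinearMap.ext fun f => ?_)
  refine Eq.trans ?_ (SymmetricAlgebra.lift_ι_apply _ f).symm
  simp [mu]

/-- On generators this is the formula for the coproduct of `e g`. Both sides are multiplicative in
`s` because the `e h` are orthogonal idempotents with sum `1`. -/
theorem symCoaction_eq_sum (s : S) :
    symCoaction k G s = ∑ h : G, symTranslateHom k h s ⊗ₜ[k] (e h : H) := by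
  have hlin (f : H) : symCoaction k G (SymmetricAlgebra.ι k H f) =
      ∑ h : G, symTranslateHom k h (SymmetricAlgebra.ι k H f) ⊗ₜ[k] (e h : H) := by
    let φ : H →ₗ[k] S ⊗[k] H := (symCoaction k G).toLinearMap ∘ₗ SymmetricAlgebra.ι k H
    let ψ : H →ₗ[k] S ⊗[k] H := ∑ h : G, (TensorProduct.mk k S H).flip (e h) ∘ₗ
      (symTranslateHom k h).toLinearMap ∘ₗ SymmetricAlgebra.ι k H
    have hφψ : φ = ψ := by
      refine linearMap_ext fun g => ?_
      simp only [φ, ψ, LinearMap.comp_apply, AlgHom.toLinearMap_apply, LinearMap.sum_apply,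
        LinearMap.flip_apply, TensorProduct.mk_apply, symTranslateHom_ι, translate_e]
      refine (SymmetricAlgebra.lift_ι_apply _ _).trans ?_
      simp [comul_e]
    have := DFunLike.congr_fun hφψ f
    simpa [φ, ψ, LinearMap.sum_apply] using this
  induction s using SymmetricAlgebra.induction with
  | algebraMap r =>
    simp only [AlgHom.commutes]
    rw [← TensorProduct.tmul_sum, sum_e, Algebra.TensorProduct.algebraMap_apply]
  | ι f => exact hlin f
  | mul a b ha hb =>
    simp only [map_mul, ha, hb, Finset.sum_mul_sum, Algebra.TensorProduct.tmul_mul_tmul, e_mul_e]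
    refine Finset.sum_congr rfl fun h _ => ?_
    rw [Finset.sum_eq_single h]
    · simp
    · intro y _ hy
      rw [if_neg (Ne.symm hy), TensorProduct.tmul_zero]
    · simp
  | add a b ha hb =>
    simp only [map_add, ha, hb, TensorProduct.add_tmul, Finset.sum_add_distrib]

/-- The coaction of `s` is `∑ x, (x · s) ⊗ e x`, while `s ⊗ 1 = ∑ x, s ⊗ e x`; comparing the
coefficients of `e x` turns coinvariance into invariance. -/
theorem mem_range_toSym_iff (s : S) :
    s ∈ (toSym k H).range ↔ ∀ x : G, symTranslateHom k x s = s := by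
  constructor
  · rintro ⟨v, hv⟩
    replace hv : toSym k H v = s := hv
    obtain ⟨P, hP⟩ := Ideal.Quotient.mkₐ_surjective k (identities k H) v.1
    have h1 := muBar_eq_tmul_one k H v
    rw [hv, ← hP, muBar_mk, mu_eq_symCoaction, symCoaction_eq_sum] at h1
    have key (x : G) : symTranslateHom k x (SymmetricAlgebra.algHom k H P) = s := by
      have h2 := congrArg (fun z => TensorProduct.rid k S ((eval k x).lTensor S z)) h1
      simp only [map_sum, LinearMap.lTensor_tmul, eval_e, TensorProduct.rid_tmul] at h2
      rw [Finset.sum_eq_single x] at h2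
      · rw [if_pos rfl, one_smul] at h2
        refine h2.trans ?_
        change (1 : k) • s = s
        rw [one_smul]
      · intro y _ hy
        rw [if_neg (Ne.symm hy), zero_smul]
      · simp
    -- So far only translates of the symmetrization of `P` are known to equal `s`; the trivial
    -- translate identifies the symmetrization itself with `s`.
    have h0 := key 1
    rw [symTranslateHom_one, AlgHom.id_apply] at h0
    intro x
    rw [← h0, key, h0]
  · intro hs
    obtain ⟨P, rfl⟩ := SymmetricAlgebra.algHom_surjective k H s
    have hmu : mu k H P = SymmetricAlgebra.algHom k H P ⊗ₜ 1 := by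
      rw [mu_eq_symCoaction, symCoaction_eq_sum]
      simp only [hs]
      rw [← TensorProduct.tmul_sum, sum_e]
    have hco : deltaU k H (Ideal.Quotient.mkₐ k (identities k H) P) =
        Ideal.Quotient.mkₐ k (identities k H) P ⊗ₜ 1 := by
      -- Coinvariance in `U_H` can be tested after applying `μ̄ ⊗ id`, which is injective by
      -- flatness over `k`.
      have hinj : Function.Injective
          (Algebra.TensorProduct.map (muBar k H) (AlgHom.id k H)) :=
        Module.Flat.rTensor_preserves_injective_linearMap (M := H) (muBar k H).toLinearMap
          (muBar_injective k H)
      apply hinj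
      rw [deltaU_mk, map_muBar, Algebra.TensorProduct.map_tmul, muBar_mk, map_one]
      apply (TensorProduct.assoc k S H H).injective
      refine (AlgHom.congr_fun (mu_comodule k H) P).trans ?_
      rw [AlgHom.comp_apply, hmu, Algebra.TensorProduct.map_tmul, map_one, AlgHom.id_apply,
        TensorProduct.assoc_tmul]
      rfl
    refine ⟨⟨Ideal.Quotient.mkₐ k (identities k H) P, hco⟩, ?_⟩
    change TensorProduct.rid k S (Algebra.TensorProduct.map (AlgHom.id k S)
      (Bialgebra.counitAlgHom k H) (mu k H P)) = _
    rw [hmu]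
    simp

theorem mem_universalCoinvariantsImage_iff (z : FracSym k H) :
    z ∈ universalCoinvariantsImage k H ↔
      z ∈ (algebraMap S (FracSym k H)).range ∧ ∀ x : G, fracTranslate k x z = z := by
  constructor
  · rintro ⟨v, rfl⟩
    refine ⟨⟨toSym k H v, rfl⟩, fun x => (fracTranslate_algebraMap k x _).trans ?_⟩
    exact congrArg _ ((mem_range_toSym_iff k G _).1 ⟨v, rfl⟩ x)
  · rintro ⟨⟨s, rfl⟩, hs⟩
    obtain ⟨v, hv⟩ := (mem_range_toSym_iff k G s).2 fun x =>
      FaithfulSMul.algebraMap_injective S (FracSym k H)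
        ((fracTranslate_algebraMap k x s).symm.trans (hs x))
    exact ⟨v, congrArg (algebraMap S (FracSym k H)) hv⟩

end Coinvariants

/-! ### Spans and traces over a subalgebra of invariants -/

/-- If `b` spans a subring over `B`, then it contains the `k`-algebra generated by `b`. -/
theorem adjoin_range_le_span {k F ι : Type*} [CommRing k] [CommRing F] [Algebra k F]
    (B : Subalgebra k F) (b : ι → F) (h1 : (1 : F) ∈ Submodule.span B (Set.range b))
    (hmul : ∀ i j, b i * b j ∈ Submodule.span B (Set.range b)) {z : F}
    (hz : z ∈ Algebra.adjoin k (Set.range b)) : z ∈ Submodule.span B (Set.range b) := by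
  induction hz using Algebra.adjoin_induction with
  | mem x hx => exact Submodule.subset_span hx
  | algebraMap r =>
    have := Submodule.smul_mem _ (algebraMap k B r) h1
    rwa [Algebra.smul_def, mul_one] at this
  | add x y _ _ hx hy => exact add_mem hx hy
  | mul x y _ _ hx hy =>
    have hle : Submodule.span B (Set.range b) * Submodule.span B (Set.range b) ≤
        Submodule.span B (Set.range b) := by
      rw [Submodule.span_mul_span, Submodule.span_le]
      rintro _ ⟨_, ⟨i, rfl⟩, _, ⟨j, rfl⟩, rfl⟩
      exact hmul i j
    exact hle (Submodule.mul_mem_mul hx hy)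

/-- An invariant element of the span over `B` of a family with traces in `B` lies in `B`, if the
order of the group is invertible and the elements of `B` are invariant. -/
theorem mem_of_invariant_of_mem_span {k F ι X : Type*} [Field k] [CommRing F] [Algebra k F]
    [Fintype X] (hX : (Fintype.card X : k) ≠ 0) (B : Subalgebra k F) (b : ι → F)
    (ρ : X → F →ₐ[k] F) (hB : ∀ x, ∀ z ∈ B, ρ x z = z) (hb : ∀ i, ∑ x, ρ x (b i) ∈ B)
    {z : F} (hz : z ∈ Submodule.span B (Set.range b)) (hinv : ∀ x, ρ x z = z) : z ∈ B := by
  have htr : ∑ x, ρ x z ∈ B := by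
    -- The trace lies in `B` for every element of the span, and the induction passes through
    -- elements that need not be invariant.
    clear hinv
    induction hz using Submodule.span_induction with
    | mem y hy =>
      obtain ⟨i, rfl⟩ := hy
      exact hb i
    | zero => simp
    | add y w _ _ hy hw => simpa [Finset.sum_add_distrib] using add_mem hy hw
    | smul a y _ hy =>
      have : ∑ x, ρ x (a • y) = a * ∑ x, ρ x y := by
        rw [Finset.mul_sum]
        refine Finset.sum_congr rfl fun x _ => ?_
        rw [Algebra.smul_def, map_mul]
        congr 1
        exact hB x _ a.2
      rw [this]
      exact mul_mem a.2 hy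
  simp only [hinv, Finset.sum_const, Finset.card_univ, ← Nat.cast_smul_eq_nsmul k] at htr
  have := B.smul_mem htr (Fintype.card X : k)⁻¹
  rwa [smul_smul, inv_mul_cancel₀ hX, one_smul] at this

/-! ### The group matrix and its inverse -/

section FunctionAlgebra

variable (k : Type*) {G : Type*} [Field k] [Group G] [Fintype G] [DecidableEq G]

local notation "H" => FunctionHopf k G
local notation "S" => SymmetricAlgebra k (FunctionHopf k G)
local notation "F" => FracSym k (FunctionHopf k G)
local notation "B" => genericBase k (FunctionHopf k G)

/-- The variable `t_g`. -/
def tVar (g : G) : F := t k H (e g)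

/-- The element `t⁻¹_g`. -/
def tInvVar (g : G) : F := tInv k H (e g)

/-- The matrix `(t_{g h⁻¹})`, whose determinant is the group determinant. -/
def groupMatrix : Matrix G G F := Matrix.of fun g h => tVar k (g * h⁻¹)

/-- The matrix `(t⁻¹_{g h⁻¹})`. -/
def groupMatrixInv : Matrix G G F := Matrix.of fun g h => tInvVar k (g * h⁻¹)

theorem sum_tVar_mul_tInvVar (g : G) :
    ∑ h : G, tVar k (g * h⁻¹) * tInvVar k h = if g = 1 then 1 else 0 := by
  have h := congrArg (fun f => f.ofConv (e g)) (t_conv_tInv k H).1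
  simp only [LinearMap.convMul_apply, LinearMap.convOne_apply, comul_e, map_sum,
    TensorProduct.map_tmul, LinearMap.mul'_apply, counit_e] at h
  refine h.trans ?_
  split_ifs <;> simp

theorem sum_tInvVar_mul_tVar (g : G) :
    ∑ h : G, tInvVar k (g * h⁻¹) * tVar k h = if g = 1 then 1 else 0 := by
  have h := congrArg (fun f => f.ofConv (e g)) (t_conv_tInv k H).2
  simp only [LinearMap.convMul_apply, LinearMap.convOne_apply, comul_e, map_sum,
    TensorProduct.map_tmul, LinearMap.mul'_apply, counit_e] at h
  refine h.trans ?_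
  split_ifs <;> simp

theorem sum_tInvVar_mul_tVar' (d : G) :
    ∑ c : G, tInvVar k c * tVar k (c⁻¹ * d) = if d = 1 then 1 else 0 := by
  rw [← sum_tInvVar_mul_tVar k d]
  refine Fintype.sum_equiv ((Equiv.inv G).trans (Equiv.mulRight d)) _ _ fun c => ?_
  simp

theorem groupMatrix_mul_groupMatrixInv :
    (groupMatrix k : Matrix G G F) * groupMatrixInv k = 1 := by
  ext g l
  rw [Matrix.mul_apply, Matrix.one_apply]
  have := sum_tVar_mul_tInvVar k (g * l⁻¹)
  simp only [mul_inv_eq_one] at this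
  rw [← this]
  refine Fintype.sum_equiv (Equiv.mulRight l⁻¹) _ _ fun h => ?_
  simp [groupMatrix, groupMatrixInv, mul_assoc]

omit [Fintype G] in
theorem fracTranslate_tVar (x g : G) : fracTranslate k x (tVar k g) = tVar k (g * x⁻¹) :=
  fracTranslate_t k x g

/-- Applying `x` to the relation between `t` and `t⁻¹` yields a second right inverse `W` of the
group matrix; uniqueness of the inverse forces right translation of the `t_g` to become left
translation of the `t⁻¹_g`. -/
theorem fracTranslate_tInvVar (x g : G) :
    fracTranslate k x (tInvVar k g) = tInvVar k (x * g) := by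
  let W : Matrix G G F := Matrix.of fun g h => fracTranslate k x (tInvVar k (x⁻¹ * (g * h⁻¹)))
  have hW : groupMatrix k * W = 1 := by
    ext g l
    have := congrArg (fracTranslate k x) (sum_tVar_mul_tInvVar k (g * l⁻¹))
    simp only [map_sum, map_mul, fracTranslate_tVar, mul_inv_eq_one] at this
    rw [Matrix.mul_apply, Matrix.one_apply]
    refine Eq.trans ?_ (this.trans (by split_ifs <;> simp))
    refine Fintype.sum_equiv ((Equiv.mulRight l⁻¹).trans (Equiv.mulLeft x⁻¹)) _ _ fun h => ?_
    simp [groupMatrix, W, mul_assoc]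
  have h := left_inv_eq_right_inv
    (mul_eq_one_comm.1 (groupMatrix_mul_groupMatrixInv k)) hW
  have h' := congrFun (congrFun h (x * g)) 1
  simpa [W, groupMatrixInv, mul_assoc] using h'.symm

/-! ### The cocycles on basis elements and the multiplication tables over `B_H` -/

theorem sigma_e (g h : G) :
    sigma k H (e g ⊗ₜ e h) =
      ∑ a : G, tVar k (g * a⁻¹) * tVar k (h * a⁻¹) * tInvVar k a := by
  rw [sigma, LinearMap.convMul_apply, TensorProduct.comul_tmul, comul_e, comul_e]
  simp only [TensorProduct.sum_tmul, TensorProduct.tmul_sum, map_sum, tt,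
    TensorProduct.AlgebraTensorModule.tensorTensorTensorComm_tmul, TensorProduct.map_tmul,
    LinearMap.comp_apply, LinearMap.mul'_apply, e_mul_e]
  refine Finset.sum_congr rfl fun a _ => ?_
  rw [Finset.sum_eq_single a]
  · simp [tVar, tInvVar]
  · intro b _ hb
    simp [hb]
  · simp

theorem sigmaInv_e (g h : G) :
    sigmaInv k H (e g ⊗ₜ e h) =
      ∑ c : G, tVar k c * (tInvVar k (c⁻¹ * g) * tInvVar k (c⁻¹ * h)) := by
  rw [sigmaInv, LinearMap.convMul_apply, TensorProduct.comul_tmul, comul_e, comul_e]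
  simp only [TensorProduct.sum_tmul, TensorProduct.tmul_sum, map_sum, ttInv,
    TensorProduct.AlgebraTensorModule.tensorTensorTensorComm_tmul, TensorProduct.map_tmul,
    LinearMap.comp_apply, LinearMap.mul'_apply, e_mul_e]
  rw [Finset.sum_comm]
  refine Fintype.sum_equiv ((Equiv.inv G).trans (Equiv.mulLeft g)) _ _ fun a => ?_
  -- The product `e (g * a⁻¹) * e (h * b⁻¹)` vanishes unless `g a⁻¹ = h b⁻¹`; the common value is
  -- the new index `c`.
  rw [Finset.sum_eq_single (a * g⁻¹ * h)]
  · simp [tVar, tInvVar, mul_assoc]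
  · intro b _ hb
    rw [if_neg, map_zero, zero_mul]
    intro hab
    exact hb (by rw [mul_assoc, ← inv_mul_eq_iff_eq_mul.2 (mul_inv_eq_iff_eq_mul.1 hab)]; group)
  · simp

theorem sigma_mem (x y : H) : sigma k H (x ⊗ₜ y) ∈ B :=
  Algebra.subset_adjoin (Or.inl ⟨x, y, rfl⟩)

theorem sigmaInv_mem (x y : H) : sigmaInv k H (x ⊗ₜ y) ∈ B :=
  Algebra.subset_adjoin (Or.inr ⟨x, y, rfl⟩)

/-- This is `t_x t_y = σ(x₁,y₁) t_{x₂y₂}`: convolving `σ` on the right with `x ⊗ y ↦ t_{xy}` cancels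
its factor `t⁻¹_{xy}`. -/
theorem tVar_mul_tVar (g h : G) :
    tVar k g * tVar k h =
      ∑ a : G, sigma k H (e (g * a⁻¹) ⊗ₜ e (h * a⁻¹)) * tVar k a := by
  simp only [sigma_e, Finset.sum_mul]
  have : ∀ a : G, ∑ c : G, tVar k (g * a⁻¹ * c⁻¹) * tVar k (h * a⁻¹ * c⁻¹) * tInvVar k c *
      tVar k a = ∑ d : G, tVar k (g * d⁻¹) * tVar k (h * d⁻¹) *
        (tInvVar k (d * a⁻¹) * tVar k a) := fun a => by
    refine Fintype.sum_equiv (Equiv.mulRight a) _ _ fun c => ?_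
    simp [mul_assoc]
  simp only [this]
  rw [Finset.sum_comm]
  simp only [← Finset.mul_sum, sum_tInvVar_mul_tVar]
  rw [Finset.sum_eq_single 1] <;> simp +contextual

/-- Dually, `t⁻¹_x t⁻¹_y = t⁻¹_{x₁y₁} σ⁻¹(x₂,y₂)`: convolving `σ⁻¹` on the left with `x ⊗ y ↦
t⁻¹_{xy}` cancels its factor `t_{xy}`. -/
theorem tInvVar_mul_tInvVar (g h : G) :
    tInvVar k g * tInvVar k h =
      ∑ c : G, sigmaInv k H (e (c⁻¹ * g) ⊗ₜ e (c⁻¹ * h)) * tInvVar k c := by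
  simp only [sigmaInv_e, Finset.sum_mul]
  have : ∀ c : G, ∑ d : G, tVar k d * (tInvVar k (d⁻¹ * (c⁻¹ * g)) *
      tInvVar k (d⁻¹ * (c⁻¹ * h))) * tInvVar k c =
      ∑ a : G, tInvVar k (a⁻¹ * g) * tInvVar k (a⁻¹ * h) *
        (tInvVar k c * tVar k (c⁻¹ * a)) := fun c => by
    refine Fintype.sum_equiv (Equiv.mulLeft c) _ _ fun d => ?_
    simp [mul_assoc]
    ring
  simp only [this]
  rw [Finset.sum_comm]
  simp only [← Finset.mul_sum, sum_tInvVar_mul_tVar']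
  rw [Finset.sum_eq_single 1] <;> simp +contextual

/-- The two sums are the values of `t` and `t⁻¹` at the unit `∑ e g` of `H`, which is group-like. -/
theorem sum_tVar_mul_sum_tInvVar :
    (∑ g : G, tVar k g) * ∑ g : G, tInvVar k g = 1 := by
  have h : ∑ g : G, ∑ h : G, tVar k (g * h⁻¹) * tInvVar k h = (1 : F) := by
    simp [sum_tVar_mul_tInvVar]
  rw [← h, Finset.sum_comm, Finset.mul_sum]
  refine Finset.sum_congr rfl fun a _ => ?_
  rw [Finset.sum_mul]
  exact Fintype.sum_equiv (Equiv.mulRight a) _ _ fun b => by simp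

/-- The source is `σ(x,1) = ε(x) t_1` with `x = e 1`, where `t_1 = ∑ t_g`. -/
theorem sum_tVar_mem : ∑ g : G, tVar k g ∈ B := by
  have h : ∑ h : G, sigma k H (e 1 ⊗ₜ e h) = ∑ g : G, tVar k g := by
    simp only [sigma_e]
    rw [Finset.sum_comm]
    have (a : G) : ∑ h : G, tVar k (1 * a⁻¹) * tVar k (h * a⁻¹) * tInvVar k a =
        (∑ g : G, tVar k g) * (tVar k (1 * a⁻¹) * tInvVar k a) := by
      rw [Finset.sum_mul]
      refine Fintype.sum_equiv (Equiv.mulRight a⁻¹) _ _ fun h => ?_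
      simp
      ring
    simp only [this, ← Finset.mul_sum, sum_tVar_mul_tInvVar, if_true, mul_one]
  rw [← h]
  exact sum_mem fun h _ => sigma_mem k _ _

/-- Likewise `σ⁻¹(x,1) = ε(x) t⁻¹_1` with `x = e 1`. -/
theorem sum_tInvVar_mem : ∑ g : G, tInvVar k g ∈ B := by
  have h : ∑ h : G, sigmaInv k H (e 1 ⊗ₜ e h) = ∑ g : G, tInvVar k g := by
    simp only [sigmaInv_e]
    rw [Finset.sum_comm]
    have (c : G) : ∑ h : G, tVar k c * (tInvVar k (c⁻¹ * 1) * tInvVar k (c⁻¹ * h)) =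
        (∑ g : G, tInvVar k g) * (tVar k c * tInvVar k c⁻¹) := by
      rw [Finset.sum_mul]
      refine Fintype.sum_equiv (Equiv.mulLeft c⁻¹) _ _ fun h => ?_
      simp
      ring
    have h1 : ∑ c : G, tVar k c * tInvVar k c⁻¹ = (1 : F) := by
      have := sum_tVar_mul_tInvVar k (1 : G)
      rw [if_pos rfl] at this
      rw [← this]
      exact Fintype.sum_equiv (Equiv.inv G) _ _ fun c => by simp
    simp only [this]
    rw [← Finset.mul_sum, h1, mul_one]
  rw [← h]
  exact sum_mem fun h _ => sigmaInv_mem k _ _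

theorem one_mem_span_tVar : (1 : F) ∈ Submodule.span B (Set.range (tVar k)) := by
  have h : (⟨_, sum_tInvVar_mem k⟩ : B) • ∑ g : G, tVar k g = 1 := by
    rw [Algebra.smul_def, mul_comm]
    exact sum_tVar_mul_sum_tInvVar k
  rw [← h]
  exact Submodule.smul_mem _ _ (sum_mem fun g _ => Submodule.subset_span ⟨g, rfl⟩)

theorem one_mem_span_tInvVar : (1 : F) ∈ Submodule.span B (Set.range (tInvVar k)) := by
  have h : (⟨_, sum_tVar_mem k⟩ : B) • ∑ g : G, tInvVar k g = 1 := by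
    rw [Algebra.smul_def]
    exact sum_tVar_mul_sum_tInvVar k
  rw [← h]
  exact Submodule.smul_mem _ _ (sum_mem fun g _ => Submodule.subset_span ⟨g, rfl⟩)

theorem tVar_mul_tVar_mem_span (g h : G) :
    tVar k g * tVar k h ∈ Submodule.span B (Set.range (tVar k)) := by
  rw [tVar_mul_tVar]
  exact sum_mem fun a _ => Submodule.smul_mem _ (⟨_, sigma_mem k _ _⟩ : B)
    (Submodule.subset_span ⟨a, rfl⟩)

theorem tInvVar_mul_tInvVar_mem_span (g h : G) :
    tInvVar k g * tInvVar k h ∈ Submodule.span B (Set.range (tInvVar k)) := by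
  rw [tInvVar_mul_tInvVar]
  exact sum_mem fun a _ => Submodule.smul_mem _ (⟨_, sigmaInv_mem k _ _⟩ : B)
    (Submodule.subset_span ⟨a, rfl⟩)

/-! ### Invariance of `B_H`, and invariants that lie in `B_H` -/

theorem fracTranslate_sigma (x : G) (a b : H) :
    fracTranslate k x (sigma k H (a ⊗ₜ b)) = sigma k H (a ⊗ₜ b) := by
  suffices h : ((TensorProduct.mk k H H).compr₂
      ((fracTranslate k x).toLinearMap ∘ₗ sigma k H)) =
      (TensorProduct.mk k H H).compr₂ (sigma k H) from LinearMap.congr_fun₂ h a b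
  refine linearMap_ext fun g => linearMap_ext fun h => ?_
  change fracTranslate k x (sigma k H (e g ⊗ₜ e h)) = sigma k H (e g ⊗ₜ e h)
  simp only [sigma_e, map_sum, map_mul, fracTranslate_tVar, fracTranslate_tInvVar]
  -- Replacing `a` by `x a` absorbs both the right translation of the `t_g` and the left translation
  -- of the `t⁻¹_g`.
  refine Fintype.sum_equiv (Equiv.mulLeft x) _ _ fun a => ?_
  simp [mul_assoc]

theorem fracTranslate_sigmaInv (x : G) (a b : H) :
    fracTranslate k x (sigmaInv k H (a ⊗ₜ b)) = sigmaInv k H (a ⊗ₜ b) := by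
  suffices h : ((TensorProduct.mk k H H).compr₂
      ((fracTranslate k x).toLinearMap ∘ₗ sigmaInv k H)) =
      (TensorProduct.mk k H H).compr₂ (sigmaInv k H) from LinearMap.congr_fun₂ h a b
  refine linearMap_ext fun g => linearMap_ext fun h => ?_
  change fracTranslate k x (sigmaInv k H (e g ⊗ₜ e h)) = sigmaInv k H (e g ⊗ₜ e h)
  simp only [sigmaInv_e, map_sum, map_mul, fracTranslate_tVar, fracTranslate_tInvVar]
  refine Fintype.sum_equiv (Equiv.mulRight x⁻¹) _ _ fun a => ?_
  simp [mul_assoc]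

theorem fracTranslate_of_mem {z : F} (hz : z ∈ B) (x : G) : fracTranslate k x z = z := by
  have hle : B ≤ AlgHom.equalizer (fracTranslate k x).toAlgHom (AlgHom.id k F) := by
    refine Algebra.adjoin_le ?_
    rintro _ (⟨a, b, rfl⟩ | ⟨a, b, rfl⟩)
    · exact fracTranslate_sigma k x a b
    · exact fracTranslate_sigmaInv k x a b
  exact hle hz

/-- The trace argument over the span of the `t_g`: the translates of any one `t_g` run through all
of them, so its trace is `∑ t_g`. -/
theorem mem_genericBase_of_mem_adjoin_tVar (hG : (Fintype.card G : k) ≠ 0) {z : F}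
    (hz : z ∈ Algebra.adjoin k (Set.range (tVar k)))
    (hinv : ∀ x : G, fracTranslate k x z = z) : z ∈ B := by
  refine mem_of_invariant_of_mem_span hG B (tVar k) (fun x => (fracTranslate k x).toAlgHom)
    (fun x z hz => fracTranslate_of_mem k hz x) (fun g => ?_)
    (adjoin_range_le_span B _ (one_mem_span_tVar k) (tVar_mul_tVar_mem_span k) hz) hinv
  convert sum_tVar_mem k (G := G) using 1
  refine Fintype.sum_equiv ((Equiv.inv G).trans (Equiv.mulLeft g)) _ _ fun x => ?_
  exact fracTranslate_tVar k x g

/-- The counterpart for `t⁻¹`, needed to place the inverse of the squared group determinant in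
`B_H`. -/
theorem mem_genericBase_of_mem_adjoin_tInvVar (hG : (Fintype.card G : k) ≠ 0) {z : F}
    (hz : z ∈ Algebra.adjoin k (Set.range (tInvVar k)))
    (hinv : ∀ x : G, fracTranslate k x z = z) : z ∈ B := by
  refine mem_of_invariant_of_mem_span hG B (tInvVar k) (fun x => (fracTranslate k x).toAlgHom)
    (fun x z hz => fracTranslate_of_mem k hz x) (fun g => ?_)
    (adjoin_range_le_span B _ (one_mem_span_tInvVar k) (tInvVar_mul_tInvVar_mem_span k) hz) hinv
  convert sum_tInvVar_mem k (G := G) using 1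
  refine Fintype.sum_equiv (Equiv.mulRight g) _ _ fun x => ?_
  exact fracTranslate_tInvVar k x g

omit [Group G] in
theorem adjoin_tVar :
    Algebra.adjoin k (Set.range (tVar k)) = (IsScalarTower.toAlgHom k S F).range := by
  apply le_antisymm
  · refine Algebra.adjoin_le ?_
    rintro _ ⟨g, rfl⟩
    exact ⟨_, rfl⟩
  · rintro _ ⟨s, rfl⟩
    have ht (f : H) : t k H f ∈ Algebra.adjoin k (Set.range (tVar k)) := by
      rw [← sum_smul_e f, map_sum]
      refine sum_mem fun g _ => ?_
      rw [map_smul]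
      exact Subalgebra.smul_mem _ (Algebra.subset_adjoin (Set.mem_range_self g)) _
    change IsScalarTower.toAlgHom k S F s ∈ _
    induction s using SymmetricAlgebra.induction with
    | algebraMap r => rw [AlgHom.commutes]; exact Subalgebra.algebraMap_mem _ r
    | ι f => exact ht f
    | mul a b ha hb => rw [map_mul]; exact mul_mem ha hb
    | add a b ha hb => rw [map_add]; exact add_mem ha hb

theorem mem_universalCoinvariantsImage_iff_adjoin (z : F) :
    z ∈ universalCoinvariantsImage k H ↔
      z ∈ Algebra.adjoin k (Set.range (tVar (G := G) k)) ∧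
        ∀ x : G, fracTranslate k x z = z := by
  rw [mem_universalCoinvariantsImage_iff, adjoin_tVar]
  exact Iff.rfl

/-! ### The group determinant as common denominator -/

/-- The group determinant. -/
def groupDet : F := (groupMatrix k : Matrix G G F).det

theorem groupDet_mul : groupDet k * (groupMatrixInv k : Matrix G G F).det = 1 := by
  rw [groupDet, ← Matrix.det_mul, groupMatrix_mul_groupMatrixInv, Matrix.det_one]

theorem det_mem_of_forall_mem {n R : Type*} [Fintype n] [DecidableEq n] [CommRing R]
    [Algebra k R] (A : Subalgebra k R) (M : Matrix n n R) (hM : ∀ i j, M i j ∈ A) :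
    M.det ∈ A := by
  rw [Matrix.det_apply']
  exact sum_mem fun σ _ => mul_mem (intCast_mem A _) (prod_mem fun i _ => hM _ _)

/-- Translation by `x` permutes the columns of the group matrix by `h ↦ x h`, so the determinant
changes by a sign, which squaring removes. -/
theorem fracTranslate_groupDet_sq (x : G) :
    fracTranslate k x (groupDet k ^ 2) = groupDet k ^ 2 := by
  have h : fracTranslate k x (groupDet k) =
      ((groupMatrix k : Matrix G G F).submatrix id (Equiv.mulLeft x)).det := by
    refine (AlgEquiv.map_det (fracTranslate k x) _).trans ?_
    congr 1
    ext g h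
    exact (fracTranslate_tVar k x _).trans (by simp [groupMatrix, mul_assoc])
  rw [map_pow, h, Matrix.det_permute', mul_pow, ← Int.cast_pow, ← Units.val_pow_eq_pow_val,
    Int.units_sq]
  simp [groupDet]

theorem groupDet_mem : groupDet k ∈ Algebra.adjoin k (Set.range (tVar (G := G) k)) :=
  det_mem_of_forall_mem k _ _ fun _ _ => Algebra.subset_adjoin (Set.mem_range_self _)

theorem groupDet_sq_mem : groupDet k ^ 2 ∈ universalCoinvariantsImage k H :=
  (mem_universalCoinvariantsImage_iff_adjoin k _).2
    ⟨pow_mem (groupDet_mem k) 2, fracTranslate_groupDet_sq k⟩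

theorem groupDet_ne_zero : (groupDet k : F) ≠ 0 := left_ne_zero_of_mul_eq_one (groupDet_mul k)

theorem det_groupMatrixInv_mem :
    (groupMatrixInv k : Matrix G G F).det ∈ Algebra.adjoin k (Set.range (tInvVar (G := G) k)) :=
  det_mem_of_forall_mem k _ _ fun _ _ => Algebra.subset_adjoin (Set.mem_range_self _)

theorem inv_groupDet :
    (groupDet k : F)⁻¹ = (groupMatrixInv k : Matrix G G F).det :=
  inv_eq_of_mul_eq_one_right (groupDet_mul k)

theorem inv_groupDet_sq_mem (hG : (Fintype.card G : k) ≠ 0) : ((groupDet k : F) ^ 2)⁻¹ ∈ B := by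
  refine mem_genericBase_of_mem_adjoin_tInvVar k hG ?_ fun x => ?_
  · rw [← inv_pow, inv_groupDet]
    exact pow_mem (det_groupMatrixInv_mem k) 2
  · rw [map_inv₀, fracTranslate_groupDet_sq]

theorem adjugate_groupMatrix :
    (groupMatrix k : Matrix G G F).adjugate = (groupDet k : F) • groupMatrixInv k := by
  have h := congrArg ((groupMatrix k : Matrix G G F).adjugate * ·)
    (groupMatrix_mul_groupMatrixInv k)
  simp only [← mul_assoc, Matrix.adjugate_mul, smul_mul_assoc, one_mul, mul_one] at h
  exact h.symm

/-- Cramer's rule: the product is an entry of the adjugate, hence a polynomial in the `t_g`. -/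
theorem groupDet_mul_tInvVar_mem (g : G) :
    groupDet k * tInvVar k g ∈ Algebra.adjoin k (Set.range (tVar (G := G) k)) := by
  have hg : groupDet k * tInvVar k g = (groupMatrix k : Matrix G G F).adjugate g 1 := by
    simp [adjugate_groupMatrix, groupMatrixInv]
  rw [hg, Matrix.adjugate_apply]
  refine det_mem_of_forall_mem k _ _ fun i j => ?_
  by_cases hi : i = 1
  · subst hi
    rw [Matrix.updateRow_self, Pi.single_apply]
    split_ifs
    · exact one_mem _
    · exact zero_mem _
  · rw [Matrix.updateRow_ne hi]
    exact Algebra.subset_adjoin (Set.mem_range_self _)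

theorem exists_groupDet_pow_mul_mem {z : F} (hz : z ∈ freeCommHopf k H) :
    ∃ n : ℕ, groupDet k ^ n * z ∈ Algebra.adjoin k (Set.range (tVar (G := G) k)) := by
  have hD := groupDet_mem k (G := G)
  have hsum : ∀ a b : F,
      (∃ n : ℕ, groupDet k ^ n * a ∈ Algebra.adjoin k (Set.range (tVar (G := G) k))) →
      (∃ n : ℕ, groupDet k ^ n * b ∈ Algebra.adjoin k (Set.range (tVar (G := G) k))) →
      ∃ n : ℕ, groupDet k ^ n * (a + b) ∈ Algebra.adjoin k (Set.range (tVar (G := G) k)) := by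
    rintro a b ⟨n, hn⟩ ⟨m, hm⟩
    refine ⟨n + m, ?_⟩
    have : groupDet k ^ (n + m) * (a + b) =
        groupDet k ^ m * (groupDet k ^ n * a) + groupDet k ^ n * (groupDet k ^ m * b) := by ring
    rw [this]
    exact add_mem (mul_mem (pow_mem hD m) hn) (mul_mem (pow_mem hD n) hm)
  induction hz using Algebra.adjoin_induction with
  | mem z hz =>
    rcases hz with ⟨f, rfl⟩ | ⟨f, rfl⟩
    · refine ⟨0, ?_⟩
      rw [pow_zero, one_mul, adjoin_tVar]
      exact ⟨_, rfl⟩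
    · refine ⟨1, ?_⟩
      rw [← sum_smul_e f, map_sum, pow_one, Finset.mul_sum]
      refine sum_mem fun g _ => ?_
      rw [map_smul, mul_smul_comm]
      exact Subalgebra.smul_mem _ (groupDet_mul_tInvVar_mem k g) _
  | algebraMap r => exact ⟨0, by simp⟩
  | add a b _ _ ha hb => exact hsum a b ha hb
  | mul a b _ _ ha hb =>
    obtain ⟨n, hn⟩ := ha
    obtain ⟨m, hm⟩ := hb
    refine ⟨n + m, ?_⟩
    have : groupDet k ^ (n + m) * (a * b) =
        (groupDet k ^ n * a) * (groupDet k ^ m * b) := by ring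
    rw [this]
    exact mul_mem hn hm

/-- A power of the determinant clears the denominators of `z`; doubling the exponent keeps the
product in `S(t_H)` and makes it invariant. -/
theorem exists_groupDet_sq_pow_mul_mem {z : F} (hz : z ∈ B) :
    ∃ n : ℕ, (groupDet k ^ 2) ^ n * z ∈ universalCoinvariantsImage k H := by
  obtain ⟨n, hn⟩ := exists_groupDet_pow_mul_mem k (genericBase_le k H hz)
  refine ⟨n, (mem_universalCoinvariantsImage_iff_adjoin k _).2 ⟨?_, fun x => ?_⟩⟩
  · have : (groupDet k ^ 2) ^ n * z = groupDet k ^ n * (groupDet k ^ n * z) := by ring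
    rw [this]
    exact mul_mem (pow_mem (groupDet_mem k) n) hn
  · rw [map_mul, map_pow, fracTranslate_groupDet_sq, fracTranslate_of_mem k hz]

end FunctionAlgebra

/-! ### Localization at the powers of one element, and the theorem -/

/-- A subalgebra `B ⊇ A` of a field that contains the inverse of `d ∈ A`, and whose elements are
carried into `A` by powers of `d`, is the localization of `A` at the powers of `d`. -/
theorem isLocalizationOf_of_pow_mul_mem {k F : Type*} [Field k] [Field F] [Algebra k F]
    {A B : Subalgebra k F} (hAB : A ≤ B) {d : F} (hd0 : d ≠ 0) (hd : d ∈ A) (hinv : d⁻¹ ∈ B)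
    (hpow : ∀ z ∈ B, ∃ n : ℕ, d ^ n * z ∈ A) : IsLocalizationOf B A := by
  let δ : A := ⟨d, hd⟩
  let _ : Algebra A B := (Subalgebra.inclusion hAB).toRingHom.toAlgebra
  have hmap (a : A) : algebraMap A B a = Subalgebra.inclusion hAB a := rfl
  refine ⟨hAB, Submonoid.powers δ, (isLocalization_iff _ _).2 ⟨?_, ?_, ?_⟩⟩
  · rintro ⟨_, n, rfl⟩
    have hu : IsUnit (algebraMap A B δ) :=
      IsUnit.of_mul_eq_one ⟨d⁻¹, hinv⟩ (Subtype.ext (mul_inv_cancel₀ hd0))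
    simpa using hu.pow n
  · rintro ⟨z, hz⟩
    obtain ⟨n, hn⟩ := hpow z hz
    exact ⟨⟨⟨_, hn⟩, ⟨δ ^ n, n, rfl⟩⟩, Subtype.ext (mul_comm z (d ^ n))⟩
  · intro a b hab
    exact ⟨1, by rw [Subalgebra.inclusion_injective hAB hab]⟩

end GenericBase

end

theorem theorem5p4 (k G : Type*) [Field k] [Group G] [Fintype G] [DecidableEq G]
    (hG : ¬ ringChar k ∣ Fintype.card G) :
    GenericBase.IsLocalizationOf
      (GenericBase.genericBase k (GenericBase.FunctionHopf k G))
      (GenericBase.universalCoinvariantsImage k (GenericBase.FunctionHopf k G)) := by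
  have hG' : (Fintype.card G : k) ≠ 0 := fun h => hG ((ringChar.spec k _).1 h)
  refine GenericBase.isLocalizationOf_of_pow_mul_mem (fun z hz => ?_)
    (pow_ne_zero 2 (GenericBase.groupDet_ne_zero k)) (GenericBase.groupDet_sq_mem k)
    (GenericBase.inv_groupDet_sq_mem k hG')
    fun z hz => GenericBase.exists_groupDet_sq_pow_mul_mem k hz
  obtain ⟨h1, h2⟩ := (GenericBase.mem_universalCoinvariantsImage_iff_adjoin k z).1 hz
  exact GenericBase.mem_genericBase_of_mem_adjoin_tVar k hG' h1 h2
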